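/- **Theorem 4.1 (algebraic stability theorem for derived categories).** Let $\Bbbk$ be an algebraically closed field, $n$ a non-negative integer, and let $\operatorname{rep}_{\Bbbk}A_n$ be the abelian category of finite-dimensional representations $M_1\to M_2\to\cdots\to M_n$ of the equioriented quiver $A_n: 1\to 2\to\cdots\to n$. For an integer $\delta\ge 0$ let $M(\delta)$ be the $\delta$-shift of $M$, i.e. $M(\delta)_x=M_{x+\delta}$ if $x+\delta\le n$ and $M(\delta)_x=0$ otherwise (with the structure maps of $M$), and let $\phi_M^{\delta}\colon M\to M(\delta)$ be the morphism given at $x$ by the composite of structure maps $M_x\to M_{x+\delta}$ (and by $0$ if $x+\delta>n$). A pair $f\colon M\to N(\delta)$, $g\colon N\to M(\delta)$ is a $\delta$-interleaving pair between $M$ and $N$ if $g(\delta)\circ f=\phi_M^{2\delta}$ and $f(\delta)\circ g=\phi_N^{2\delta}$. The functor $(\delta)$ is exact and induces a functor on $\mathsf D^{\mathrm b}(\operatorname{rep}_{\Bbbk}A_n)$ with $H^i(X(\delta))=H^i(X)(\delta)$. Objects $X,Y$ of $\mathsf D^{\mathrm b}(\operatorname{rep}_{\Bbbk}A_n)$ are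 derived $\delta$-interleaved if there are morphisms $f\colon X\to Y(\delta)$ and $g\colon Y\to X(\delta)$ in $\mathsf D^{\mathrm b}(\operatorname{rep}_{\Bbbk}A_n)$ such that $(H^i(f),H^i(g))$ is a $\delta$-interleaving pair between $H^i(X)$ and $H^i(Y)$ for every $i\in\mathbb Z$. The derived interleaving distance is $$d_I^D(X,Y)=\inf\{\delta\in\mathbb Z_{\ge0}\mid X\text{ and }Y\text{ are derived }\delta\text{-interleaved}\}\quad(\inf\emptyset=\infty).$$ For $1\le b\le d\le n$ let $\mathbb I[b,d]$ be the interval representation, equal to $\Bbbk$ at the vertices $b,\dots,d$ (with identity maps between them) and to $0$ elsewhere. The barcode $\mathcal B(M)$ of $M$ is the multiset in which the interval $\langle b,d\rangle$ has multiplicity $m(b,d)$, where $M\cong\bigoplus_{b\le d}\mathbb I[b,d]^{m(b,d)}$. The derived barcode $\mathcal B^D(X)$ is the disjoint union of the barcodes $\mathcal B(H^i(X))$, $i\in\mathbb Z$. Two barcodes $\mathcal B,\mathcal B'$ are $\delta$-matched if there is a bijection $\sigma$ from a subset of $\mathcal B$ to a subset of $\mathcal B'$ whose domain contains all intervals of $\mathcal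 B$ with $d-b\ge2\delta$, whose image contains all intervals of $\mathcal B'$ with $d-b\ge2\delta$, and such that $\sigma\langle b,d\rangle=\langle b',d'\rangle$ implies $|b-b'|\le\delta$ and $|d-d'|\le\delta$. Two derived barcodes are $\delta$-matched if their degree-$i$ parts are $\delta$-matched for every $i\in\mathbb Z$, and $$d_B^D(\mathcal B^D(X),\mathcal B^D(Y))=\inf\{\delta\in\mathbb Z_{\ge0}\mid\mathcal B^D(X)\text{ and }\mathcal B^D(Y)\text{ are }\delta\text{-matched}\}\quad(\inf\emptyset=\infty).$$ Then for all objects $X,Y$ of $\mathsf D^{\mathrm b}(\operatorname{rep}_{\Bbbk}A_n)$ the barcodes of all $H^i(X)$ and $H^i(Y)$ exist (i.e. these representations decompose as direct sums of interval representations), and $$d_B^D(\mathcal B^D(X),\mathcal B^D(Y))\le d_I^D(X,Y).$$ -/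

import Mathlib

universe w u v

namespace PersistenceAST

open CategoryTheory CategoryTheory.Limits
open scoped ZeroObject

noncomputable section

/-! ### Persistence modules, their shifts and transition morphisms

The quiver `1 → 2 → ⋯ → n` has exactly one path from `s` to `t` when `s ≤ t` and none otherwise, so
its path category is the poset `Fin n` (vertices numbered from `0`) and a representation with values
in `C` is a functor `M : Fin n ⥤ C`. The composite `M_s ⟶ ⋯ ⟶ M_t` of structure maps is
`M.map (homOfLE h)` with `h : s ≤ t`. -/

section Shift

variable {C : Type u} [Category.{v} C] [HasZeroObject C] [HasZeroMorphisms C] {n : ℕ}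

set_option linter.unusedSectionVars false

/-- The space `M(δ)_x`: it is `M_{x+δ}` if `x + δ` is a vertex, and `0` otherwise. -/
def shiftObjAt (δ : ℕ) (M : Fin n ⥤ C) (x : Fin n) : C :=
  if h : x.1 + δ < n then M.obj ⟨x.1 + δ, h⟩ else 0

/-- The identification `M(δ)_x = M_{x+δ}`. -/
def shiftObjAtIso (δ : ℕ) (M : Fin n ⥤ C) (x : Fin n) (h : x.1 + δ < n) :
    shiftObjAt δ M x ≅ M.obj ⟨x.1 + δ, h⟩ :=
  eqToIso (dif_pos h)

lemma isZero_shiftObjAt (δ : ℕ) (M : Fin n ⥤ C) (x : Fin n) (h : ¬ x.1 + δ < n) :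
    IsZero (shiftObjAt δ M x) := by
  rw [shiftObjAt, dif_neg h]
  exact isZero_zero C

/-- The structure map `M(δ)_x ⟶ M(δ)_y`: it is `M_{x+δ} ⟶ M_{y+δ}` if `y + δ` is a vertex, and
`0` otherwise. -/
def shiftMapAt (δ : ℕ) (M : Fin n ⥤ C) {x y : Fin n} (hxy : x ≤ y) :
    shiftObjAt δ M x ⟶ shiftObjAt δ M y :=
  if h : y.1 + δ < n then
    (shiftObjAtIso δ M x (lt_of_le_of_lt (Nat.add_le_add_right hxy δ) h)).hom ≫
      M.map (homOfLE (Nat.add_le_add_right hxy δ)) ≫ (shiftObjAtIso δ M y h).inv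
  else 0

/-- The `δ`-shift `M(δ)` of a persistence module. -/
def shiftObj (δ : ℕ) (M : Fin n ⥤ C) : Fin n ⥤ C where
  obj x := shiftObjAt δ M x
  map f := shiftMapAt δ M f.le
  map_id x := by
    by_cases h : x.1 + δ < n
    · simp [shiftMapAt, h]
    · exact (isZero_shiftObjAt δ M x h).eq_of_src _ _
  map_comp {x y z} f g := by
    by_cases h : z.1 + δ < n
    · have h' : y.1 + δ < n := lt_of_le_of_lt (Nat.add_le_add_right g.le δ) h
      simp only [shiftMapAt, h, h', dif_pos, Category.assoc, Iso.inv_hom_id_assoc]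
      rw [← Functor.map_comp_assoc]
      rfl
    · exact (isZero_shiftObjAt δ M z h).eq_of_tgt _ _

/-- The `δ`-shift `f(δ)` of a morphism at `x`: it is `f_{x+δ}` if `x + δ` is a vertex,
and `0` otherwise. -/
def shiftHomAt (δ : ℕ) {M N : Fin n ⥤ C} (f : M ⟶ N) (x : Fin n) :
    shiftObjAt δ M x ⟶ shiftObjAt δ N x :=
  if h : x.1 + δ < n then
    (shiftObjAtIso δ M x h).hom ≫ f.app ⟨x.1 + δ, h⟩ ≫ (shiftObjAtIso δ N x h).inv
  else 0

/-- The `δ`-shift functor on persistence modules. -/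
def shift (C : Type u) [Category.{v} C] [HasZeroObject C] [HasZeroMorphisms C] (n δ : ℕ) :
    (Fin n ⥤ C) ⥤ (Fin n ⥤ C) where
  obj M := shiftObj δ M
  map {M N} f :=
    { app := fun x => shiftHomAt δ f x
      naturality := fun x y g => by
        change shiftMapAt δ M g.le ≫ _ = _ ≫ shiftMapAt δ N g.le
        by_cases h : y.1 + δ < n
        · have h' : x.1 + δ < n := lt_of_le_of_lt (Nat.add_le_add_right g.le δ) h
          simp [shiftMapAt, shiftHomAt, h, h']
        · exact (isZero_shiftObjAt δ N y h).eq_of_tgt _ _ }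
  map_id M := by
    ext x
    change shiftHomAt δ (𝟙 M) x = 𝟙 (shiftObjAt δ M x)
    by_cases h : x.1 + δ < n
    · simp [shiftHomAt, h]
    · exact (isZero_shiftObjAt δ M x h).eq_of_tgt _ _
  map_comp {M N P} f g := by
    ext x
    change shiftHomAt δ (f ≫ g) x = shiftHomAt δ f x ≫ shiftHomAt δ g x
    by_cases h : x.1 + δ < n
    · simp [shiftHomAt, h]
    · exact (isZero_shiftObjAt δ P x h).eq_of_tgt _ _

/-- The component `M_x ⟶ M(δ)_x` of the transition morphism: it is the composite of structure maps
`M_x ⟶ M_{x+δ}` if `x + δ` is a vertex, and `0` otherwise. -/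
def transitionAt (δ : ℕ) (M : Fin n ⥤ C) (x : Fin n) : M.obj x ⟶ shiftObjAt δ M x :=
  if h : x.1 + δ < n then
    M.map (homOfLE (show x.1 ≤ x.1 + δ from Nat.le_add_right _ _) : x ⟶ ⟨x.1 + δ, h⟩) ≫
      (shiftObjAtIso δ M x h).inv
  else 0

/-- The transition morphism `φ_M^δ : M ⟶ M(δ)`. -/
def transition (δ : ℕ) (M : Fin n ⥤ C) : M ⟶ (shift C n δ).obj M where
  app x := transitionAt δ M x
  naturality x y g := by
    change M.map g ≫ transitionAt δ M y = transitionAt δ M x ≫ shiftMapAt δ M g.le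
    by_cases h : y.1 + δ < n
    · have h' : x.1 + δ < n := lt_of_le_of_lt (Nat.add_le_add_right g.le δ) h
      simp only [transitionAt, shiftMapAt, h, h', dif_pos, Category.assoc, Iso.inv_hom_id_assoc]
      rw [← Functor.map_comp_assoc, ← Functor.map_comp_assoc]
      rfl
    · exact (isZero_shiftObjAt δ M y h).eq_of_tgt _ _

/-- The identification `M(δ)_x = M_z` for a vertex `z = x + δ`. -/
def shiftObjIso (δ : ℕ) (M : Fin n ⥤ C) (x z : Fin n) (h : x.1 + δ = z.1) :
    (shiftObj δ M).obj x ≅ M.obj z :=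
  shiftObjAtIso δ M x (h ▸ z.2) ≪≫ M.mapIso (eqToIso (Fin.ext h))

lemma shiftObj_map_shiftObjIso (δ : ℕ) (M : Fin n ⥤ C) {x y z w : Fin n} (f : x ⟶ y) (g : z ⟶ w)
    (h : x.1 + δ = z.1) (h' : y.1 + δ = w.1) :
    (shiftObj δ M).map f ≫ (shiftObjIso δ M y w h').hom = (shiftObjIso δ M x z h).hom ≫ M.map g := by
  obtain ⟨z, hz⟩ := z
  obtain ⟨w, hw⟩ := w
  dsimp only at h h'
  subst h h'
  have e : shiftMapAt δ M f.le ≫ (shiftObjAtIso δ M y hw).hom =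
      (shiftObjAtIso δ M x hz).hom ≫ M.map g := by
    simp only [shiftMapAt, hw, dif_pos, Category.assoc, Iso.inv_hom_id, Category.comp_id]
    rfl
  have e₁ : (shiftObjIso δ M x ⟨x.1 + δ, hz⟩ rfl).hom = (shiftObjAtIso δ M x hz).hom := by
    change (shiftObjAtIso δ M x hz).hom ≫ M.map (𝟙 _) = _
    rw [M.map_id, Category.comp_id]
  have e₂ : (shiftObjIso δ M y ⟨y.1 + δ, hw⟩ rfl).hom = (shiftObjAtIso δ M y hw).hom := by
    change (shiftObjAtIso δ M y hw).hom ≫ M.map (𝟙 _) = _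
    rw [M.map_id, Category.comp_id]
  rw [e₁, e₂]
  exact e

/-- The identification `M(b)(a)_x = M_{x+a+b} = M(a + b)_x` (both sides vanish if `x + a + b` is not
a vertex). -/
def shiftShiftIsoAt (a b : ℕ) (M : Fin n ⥤ C) (x : Fin n) :
    (shiftObj a (shiftObj b M)).obj x ≅ (shiftObj (a + b) M).obj x :=
  if h : x.1 + (a + b) < n then
    shiftObjIso a (shiftObj b M) x ⟨x.1 + a, by omega⟩ rfl ≪≫
      shiftObjIso b M ⟨x.1 + a, by omega⟩ ⟨x.1 + (a + b), h⟩ (Nat.add_assoc _ _ _) ≪≫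
      (shiftObjIso (a + b) M x ⟨x.1 + (a + b), h⟩ rfl).symm
  else
    (show IsZero ((shiftObj a (shiftObj b M)).obj x) by
      by_cases h' : x.1 + a < n
      · exact (isZero_shiftObjAt b M ⟨x.1 + a, h'⟩ (by simpa [Nat.add_assoc] using h)).of_iso
          (shiftObjIso a (shiftObj b M) x ⟨x.1 + a, h'⟩ rfl)
      · exact isZero_shiftObjAt a _ x h').iso (isZero_shiftObjAt (a + b) M x h)

/-- The identification `M(b)(a) = M(a + b)` for non-negative `a` and `b`. -/
def shiftShiftIso (a b : ℕ) (M : Fin n ⥤ C) :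
    (shift C n a).obj ((shift C n b).obj M) ≅ (shift C n (a + b)).obj M :=
  NatIso.ofComponents (fun x => shiftShiftIsoAt a b M x) (by
    intro x y g
    change (shiftObj a (shiftObj b M)).map g ≫ (shiftShiftIsoAt a b M y).hom =
      (shiftShiftIsoAt a b M x).hom ≫ (shiftObj (a + b) M).map g
    by_cases h : y.1 + (a + b) < n
    · have hg : x.1 ≤ y.1 := g.le
      have hx : x.1 + (a + b) < n := by omega
      have e₁ := shiftObj_map_shiftObjIso a (shiftObj b M) g
        (homOfLE (Nat.add_le_add_right hg a) : (⟨x.1 + a, by omega⟩ : Fin n) ⟶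
          ⟨y.1 + a, by omega⟩) rfl rfl
      have e₂ := shiftObj_map_shiftObjIso b M
        (homOfLE (Nat.add_le_add_right hg a) : (⟨x.1 + a, by omega⟩ : Fin n) ⟶
          ⟨y.1 + a, by omega⟩)
        (homOfLE (Nat.add_le_add_right hg (a + b)) : (⟨x.1 + (a + b), hx⟩ : Fin n) ⟶
          ⟨y.1 + (a + b), h⟩) (Nat.add_assoc _ _ _) (Nat.add_assoc _ _ _)
      have e₃ := shiftObj_map_shiftObjIso (a + b) M g
        (homOfLE (Nat.add_le_add_right hg (a + b)) : (⟨x.1 + (a + b), hx⟩ : Fin n) ⟶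
          ⟨y.1 + (a + b), h⟩) rfl rfl
      simp only [shiftShiftIsoAt, h, hx, dif_pos, Iso.trans_hom, Iso.symm_hom, Category.assoc]
      rw [reassoc_of% e₁, reassoc_of% e₂]
      congr 2
      rw [Iso.eq_inv_comp, ← reassoc_of% e₃, Iso.hom_inv_id, Category.comp_id]
    · exact (isZero_shiftObjAt (a + b) M y h).eq_of_tgt _ _)

end Shift

section ShiftExact

variable (C : Type u) [Category.{v} C] [Abelian C] (n δ : ℕ)

instance shift_additive : (shift C n δ).Additive where
  map_add {M N f g} := by
    ext x
    change shiftHomAt δ (f + g) x = shiftHomAt δ f x + shiftHomAt δ g x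
    by_cases h : x.1 + δ < n
    · simp [shiftHomAt, h]
    · exact (isZero_shiftObjAt δ N x h).eq_of_tgt _ _

/-- At a vertex `x` such that `x + δ` is a vertex, `M ↦ M(δ)_x` is evaluation at `x + δ`. -/
def shiftEvaluationIso (x : Fin n) (h : x.1 + δ < n) :
    shift C n δ ⋙ (evaluation (Fin n) C).obj x ≅ (evaluation (Fin n) C).obj ⟨x.1 + δ, h⟩ :=
  NatIso.ofComponents (fun M => shiftObjAtIso δ M x h) (by
    intro M N f
    change shiftHomAt δ f x ≫ _ = _ ≫ f.app _
    simp [shiftHomAt, h])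

instance shift_preservesFiniteLimits : PreservesFiniteLimits (shift C n δ) :=
  preservesFiniteLimits_of_evaluation _ fun x => by
    by_cases h : x.1 + δ < n
    · exact preservesFiniteLimits_of_natIso (shiftEvaluationIso C n δ x h).symm
    · exact ⟨fun J _ _ => ⟨fun {K} => ⟨fun {c} _ => ⟨IsLimit.ofIsZero _
        (Functor.isZero _ fun j => isZero_shiftObjAt δ (K.obj j) x h)
        (isZero_shiftObjAt δ c.pt x h)⟩⟩⟩⟩

instance shift_preservesFiniteColimits : PreservesFiniteColimits (shift C n δ) :=
  preservesFiniteColimits_of_evaluation _ fun x => by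
    by_cases h : x.1 + δ < n
    · exact preservesFiniteColimits_of_natIso (shiftEvaluationIso C n δ x h).symm
    · exact ⟨fun J _ _ => ⟨fun {K} => ⟨fun {c} _ => ⟨IsColimit.ofIsZero _
        (Functor.isZero _ fun j => isZero_shiftObjAt δ (K.obj j) x h)
        (isZero_shiftObjAt δ c.pt x h)⟩⟩⟩⟩

end ShiftExact

/-! ### Interleavings -/

section Interleaving

variable {C : Type u} [Category.{v} C] [HasZeroObject C] [HasZeroMorphisms C] {n : ℕ}

/-- `(f, g)` is a `δ`-interleaving pair: `g(δ) ∘ f = φ_M^{2δ}` and `f(δ) ∘ g = φ_N^{2δ}`. -/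
def IsInterleavingPair (δ : ℕ) {M N : Fin n ⥤ C}
    (f : M ⟶ (shift C n δ).obj N) (g : N ⟶ (shift C n δ).obj M) : Prop :=
  f ≫ (shift C n δ).map g ≫ (shiftShiftIso δ δ M).hom = transition (δ + δ) M ∧
  g ≫ (shift C n δ).map f ≫ (shiftShiftIso δ δ N).hom = transition (δ + δ) N

end Interleaving

/-! ### The shift on the bounded derived category, and derived interleavings -/

section Derived

variable (C : Type u) [Category.{v} C] [Abelian C] (n : ℕ) [HasDerivedCategory.{w} (Fin n ⥤ C)]

/-- The exact functor `(δ)` commutes with cohomology of cochain complexes. -/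
def shiftHomologyIsoComplex (δ : ℕ) (i : ℤ) :
    (shift C n δ).mapHomologicalComplex (ComplexShape.up ℤ) ⋙
      HomologicalComplex.homologyFunctor (Fin n ⥤ C) (ComplexShape.up ℤ) i ≅
    HomologicalComplex.homologyFunctor (Fin n ⥤ C) (ComplexShape.up ℤ) i ⋙ shift C n δ :=
  NatIso.ofComponents (fun K => (K.sc i).mapHomologyIso (shift C n δ)) (by
    intro K L f
    exact ShortComplex.mapHomologyIso_hom_naturality
      ((HomologicalComplex.shortComplexFunctor _ _ i).map f) (shift C n δ))

/-- The functor `(δ)` on the derived category, induced by the exact functor `(δ)` applied degreewise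
to complexes, commutes with cohomology. -/
def shiftHomologyIso (δ : ℕ) (i : ℤ) :
    (shift C n δ).mapDerivedCategory ⋙ DerivedCategory.homologyFunctor (Fin n ⥤ C) i ≅
      DerivedCategory.homologyFunctor (Fin n ⥤ C) i ⋙ shift C n δ :=
  Localization.liftNatIso DerivedCategory.Q
    (HomologicalComplex.quasiIso (Fin n ⥤ C) (ComplexShape.up ℤ))
    (DerivedCategory.Q ⋙ (shift C n δ).mapDerivedCategory ⋙
      DerivedCategory.homologyFunctor (Fin n ⥤ C) i)
    (DerivedCategory.Q ⋙ DerivedCategory.homologyFunctor (Fin n ⥤ C) i ⋙ shift C n δ) _ _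
    (Functor.isoWhiskerRight (shift C n δ).mapDerivedCategoryFactors
        (DerivedCategory.homologyFunctor (Fin n ⥤ C) i) ≪≫
      Functor.isoWhiskerLeft ((shift C n δ).mapHomologicalComplex (ComplexShape.up ℤ))
        (DerivedCategory.homologyFunctorFactors (Fin n ⥤ C) i) ≪≫
      shiftHomologyIsoComplex C n δ i ≪≫
      Functor.isoWhiskerRight (DerivedCategory.homologyFunctorFactors (Fin n ⥤ C) i).symm
        (shift C n δ))

lemma bounded_shift (δ : ℕ) (X : DerivedCategory.Bounded (Fin n ⥤ C)) :
    (DerivedCategory.TStructure.t (C := Fin n ⥤ C)).bounded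
      ((shift C n δ).mapDerivedCategory.obj X.obj) := by
  obtain ⟨⟨a, ha⟩, ⟨b, hb⟩⟩ := X.property
  refine ⟨⟨a, (DerivedCategory.isGE_iff _ _).2 fun i hi => ?_⟩,
    ⟨b, (DerivedCategory.isLE_iff _ _).2 fun i hi => ?_⟩⟩
  · exact ((shift C n δ).map_isZero ((DerivedCategory.isGE_iff _ _).1 ha i hi)).of_iso
      ((shiftHomologyIso C n δ i).app X.obj)
  · exact ((shift C n δ).map_isZero ((DerivedCategory.isLE_iff _ _).1 hb i hi)).of_iso
      ((shiftHomologyIso C n δ i).app X.obj)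

/-- The `δ`-shift functor on the bounded derived category of persistence modules. -/
def boundedShift (δ : ℕ) :
    DerivedCategory.Bounded (Fin n ⥤ C) ⥤ DerivedCategory.Bounded (Fin n ⥤ C) :=
  ObjectProperty.lift _ (DerivedCategory.Bounded.ι ⋙ (shift C n δ).mapDerivedCategory)
    (bounded_shift C n δ)

/-- The cohomology functor `H^i` on the bounded derived category. -/
def cohomology (i : ℤ) : DerivedCategory.Bounded (Fin n ⥤ C) ⥤ (Fin n ⥤ C) :=
  DerivedCategory.Bounded.ι ⋙ DerivedCategory.homologyFunctor (Fin n ⥤ C) i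

/-- The identification `H^i(X(δ)) = H^i(X)(δ)`. -/
def cohomologyShiftIso (δ : ℕ) (i : ℤ) :
    boundedShift C n δ ⋙ cohomology C n i ≅ cohomology C n i ⋙ shift C n δ :=
  Functor.isoWhiskerLeft DerivedCategory.Bounded.ι (shiftHomologyIso C n δ i)

variable {C n}

/-- The morphism `H^i(f) : H^i(X) ⟶ H^i(Y)(δ)` induced by `f : X ⟶ Y(δ)` in the bounded derived
category. -/
def cohomologyMap {δ : ℕ} {X Y : DerivedCategory.Bounded (Fin n ⥤ C)}
    (f : X ⟶ (boundedShift C n δ).obj Y) (i : ℤ) :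
    (cohomology C n i).obj X ⟶ (shift C n δ).obj ((cohomology C n i).obj Y) :=
  (cohomology C n i).map f ≫ (cohomologyShiftIso C n δ i).hom.app Y

/-- `X` and `Y` are derived `δ`-interleaved: there are morphisms `f : X ⟶ Y(δ)` and `g : Y ⟶ X(δ)`
in the bounded derived category that induce a `δ`-interleaving pair on every cohomology. -/
def DerivedInterleaved (δ : ℕ) (X Y : DerivedCategory.Bounded (Fin n ⥤ C)) : Prop :=
  ∃ (f : X ⟶ (boundedShift C n δ).obj Y) (g : Y ⟶ (boundedShift C n δ).obj X),
    ∀ i : ℤ, IsInterleavingPair δ (cohomologyMap f i) (cohomologyMap g i)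

/-- The derived interleaving distance, the infimum (in `ℕ∞`, so `⊤` if there is none) of all `δ`
such that `X` and `Y` are derived `δ`-interleaved. -/
def derivedInterleavingDist (X Y : DerivedCategory.Bounded (Fin n ⥤ C)) : ℕ∞ :=
  sInf {e : ℕ∞ | ∃ δ : ℕ, e = δ ∧ DerivedInterleaved δ X Y}

end Derived

/-! ### Barcodes -/

/-- An interval `⟨b, d⟩` with vertices `b ≤ d`. -/
abbrev Interval (n : ℕ) : Type := {p : Fin n × Fin n // p.1 ≤ p.2}

namespace Interval

variable {n : ℕ}

/-- The left end `b` of `⟨b, d⟩`. -/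
def birth (I : Interval n) : Fin n := I.1.1

/-- The right end `d` of `⟨b, d⟩`. -/
def death (I : Interval n) : Fin n := I.1.2

/-- The interval contains the vertex `x`. -/
def Contains (I : Interval n) (x : Fin n) : Prop := I.birth ≤ x ∧ x ≤ I.death

open scoped Classical in
/-- The space `𝕀[b,d]_x`: it is the one-dimensional space `k` if `b ≤ x ≤ d`, and `0` otherwise. -/
def repObj (k : Type u) [Field k] (I : Interval n) (x : Fin n) : FGModuleCat.{u} k :=
  if I.Contains x then FGModuleCat.of k k else 0

/-- The identification `𝕀[b,d]_x = k` for `b ≤ x ≤ d`. -/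
def repObjIso (k : Type u) [Field k] (I : Interval n) (x : Fin n) (h : I.Contains x) :
    I.repObj k x ≅ FGModuleCat.of k k :=
  eqToIso (if_pos h)

lemma isZero_repObj (k : Type u) [Field k] (I : Interval n) (x : Fin n) (h : ¬ I.Contains x) :
    IsZero (I.repObj k x) := by
  rw [repObj, if_neg h]
  exact isZero_zero _

open scoped Classical in
/-- The structure map `𝕀[b,d]_x ⟶ 𝕀[b,d]_y`: it is the identity of `k` if `b ≤ x` and `y ≤ d`, and
`0` otherwise. -/
def repMap (k : Type u) [Field k] (I : Interval n) (x y : Fin n) : I.repObj k x ⟶ I.repObj k y :=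
  if h : I.Contains x ∧ I.Contains y then
    (I.repObjIso k x h.1).hom ≫ (I.repObjIso k y h.2).inv
  else 0

/-- The interval representation `𝕀[b,d]`. -/
def rep (k : Type u) [Field k] (I : Interval n) : Fin n ⥤ FGModuleCat.{u} k where
  obj x := I.repObj k x
  map {x y} _ := I.repMap k x y
  map_id x := by
    by_cases h : I.Contains x
    · simp [repMap, h]
    · exact (I.isZero_repObj k x h).eq_of_src _ _
  map_comp {x y z} f g := by
    by_cases hx : I.Contains x
    · by_cases hz : I.Contains z
      · have hy : I.Contains y := ⟨hx.1.trans f.le, g.le.trans hz.2⟩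
        simp [repMap, hx, hy, hz]
      · exact (I.isZero_repObj k z hz).eq_of_tgt _ _
    · exact (I.isZero_repObj k x hx).eq_of_src _ _

end Interval

/-- A barcode: a finite multiset of intervals, given by the multiplicities `m(b,d)`. -/
abbrev Barcode (n : ℕ) : Type := Interval n → ℕ

namespace Barcode

variable {n : ℕ}

/-- The elements `(b, d, j)`, `j < m(b,d)`, of a barcode: each interval `⟨b, d⟩` is repeated
according to its multiplicity. -/
abbrev Bar (B : Barcode n) : Type := Σ I : Interval n, Fin (B I)

/-- `σ` is a `δ`-matching. A matching, i.e. a bijection between a subset `Coim σ` of the first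
barcode and a subset `Im σ` of the second one, is a `PEquiv`. -/
def IsMatching (δ : ℕ) {B B' : Barcode n} (σ : B.Bar ≃. B'.Bar) : Prop :=
  (∀ x : B.Bar, (x.1.birth : ℕ) + 2 * δ ≤ x.1.death → ∃ y, y ∈ σ x) ∧
  (∀ y : B'.Bar, (y.1.birth : ℕ) + 2 * δ ≤ y.1.death → ∃ x, y ∈ σ x) ∧
  ∀ (x : B.Bar) (y : B'.Bar), y ∈ σ x →
    ((y.1.birth : ℕ) ≤ x.1.birth + δ ∧ (x.1.death : ℕ) ≤ y.1.death + δ) ∧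
    ((x.1.birth : ℕ) ≤ y.1.birth + δ ∧ (y.1.death : ℕ) ≤ x.1.death + δ)

/-- Two barcodes are `δ`-matched. -/
def Matched (δ : ℕ) (B B' : Barcode n) : Prop :=
  ∃ σ : B.Bar ≃. B'.Bar, IsMatching δ σ

end Barcode

section ModuleBarcode

variable {k : Type u} [Field k] {n : ℕ}

instance : HasFiniteBiproducts (Fin n ⥤ FGModuleCat.{u} k) := Abelian.hasFiniteBiproducts

/-- `B` is a barcode of `M`: `M` is isomorphic to the direct sum of the interval representations
`𝕀[b,d]` taken `m(b,d)` times. -/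
def IsBarcode (M : Fin n ⥤ FGModuleCat.{u} k) (B : Barcode n) : Prop :=
  Nonempty (M ≅ ⨁ fun x : B.Bar => x.1.rep k)

open scoped Classical in
/-- The barcode of a persistence module, i.e. the family of multiplicities of its interval
decomposition (with the empty barcode as value if there were no decomposition). -/
def barcode (M : Fin n ⥤ FGModuleCat.{u} k) : Barcode n :=
  if h : ∃ B, IsBarcode M B then h.choose else fun _ => 0

variable [HasDerivedCategory.{w} (Fin n ⥤ FGModuleCat.{u} k)]

/-- The derived barcode: the disjoint union over all degrees `i` of the barcodes of `H^i(X)`, i.e.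
the family of these barcodes indexed by the degree. -/
def derivedBarcode (X : DerivedCategory.Bounded (Fin n ⥤ FGModuleCat.{u} k)) : ℤ → Barcode n :=
  fun i => barcode ((cohomology (FGModuleCat.{u} k) n i).obj X)

end ModuleBarcode

/-- Two derived barcodes are `δ`-matched if they are `δ`-matched in every degree. -/
def DerivedMatched {n : ℕ} (δ : ℕ) (B B' : ℤ → Barcode n) : Prop :=
  ∀ i : ℤ, Barcode.Matched δ (B i) (B' i)

/-- The derived bottleneck distance, the infimum (in `ℕ∞`, so `⊤` if there is none) of all `δ` such
that the derived barcodes are `δ`-matched. -/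
def derivedBottleneckDist {n : ℕ} (B B' : ℤ → Barcode n) : ℕ∞ :=
  sInf {e : ℕ∞ | ∃ δ : ℕ, e = δ ∧ DerivedMatched δ B B'}

end

end PersistenceAST

/-!
# Stability of derived barcodes

A derived `δ`-interleaving is, by definition, a pair of morphisms inducing a `δ`-interleaving pair
on every cohomology, and derived barcodes are matched degreewise. So the inequality follows from the
stability theorem for persistence modules over `Fin n`: `δ`-interleaved modules have `δ`-matched
barcodes (`IsInterleavingPair.matched`), together with the existence of barcodes
(`exists_isBarcode`).

Existence: if `[b, d]` is an interval of maximal length with `M_b ⟶ M_d` nonzero, then, by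
maximality, a vector of `M_b` not killed in `M_d` and a linear form on `M_d` that is `1` on its
image give morphisms `𝕀[b,d] ⟶ M ⟶ 𝕀[b,d]` with composite the identity
(`exists_interval_retract`). The complement has smaller total dimension, and induction applies.

Stability, after Bjerkevik: in bases adapted to the decompositions, interleaving morphisms become
coefficient matrices between the sets of bars (`coefficient`), and the interleaving identities say
that the products of these matrices are identity matrices wherever the composite can be seen
(`sum_coefficient_mul`). Restricted to a set `A` of bars of length at least `2δ`, ordered by
midpoint, such a product is unitriangular and already factors through the bars that are `δ`-close to
an element of `A`. Comparing ranks gives Hall's condition (`exists_injective_endpointsClose`). This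
yields an injection on the long bars of either side, and a Schröder–Bernstein argument combines both
into one matching (`exists_pEquiv_of_injective`).
-/

namespace PersistenceAST

/-! ### Matchings from one-sided injections -/

/-- Two injections, each defined on the elements that have to be matched, combine to a single
partial matching. Adding countably many dummy elements on both sides, to which exactly the elements
that may stay unmatched are allowed to be related, reduces this to the Schröder–Bernstein theorem
for injections compatible with a relation. -/
lemma exists_pEquiv_of_injective {X Y : Type*} [Fintype X] [Fintype Y] {PX : X → Prop}
    {PY : Y → Prop} (R : X → Y → Prop)
    (s : {x // PX x} → Y) (hs : Function.Injective s) (hsR : ∀ x, R x.1 (s x))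
    (t : {y // PY y} → X) (ht : Function.Injective t) (htR : ∀ y, R (t y) y.1) :
    ∃ σ : X ≃. Y, (∀ x, PX x → ∃ y, y ∈ σ x) ∧ (∀ y, PY y → ∃ x, y ∈ σ x) ∧
      ∀ x y, y ∈ σ x → R x y := by
  classical
  let eX := Fintype.equivFin X
  let eY := Fintype.equivFin Y
  let f : X ⊕ ℕ → Y ⊕ ℕ := Sum.elim
    (fun x => if h : PX x then .inl (s ⟨x, h⟩) else .inr (eX x))
    (fun m => .inr (m + Fintype.card X))
  let g : Y ⊕ ℕ → X ⊕ ℕ := Sum.elim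
    (fun y => if h : PY y then .inl (t ⟨y, h⟩) else .inr (eY y))
    (fun m => .inr (m + Fintype.card Y))
  have hf : Function.Injective f := by
    rintro (x | m) (x' | m') h
    · by_cases h₁ : PX x <;> by_cases h₂ : PX x' <;> simp [f, h₁, h₂] at h
      · simpa using hs h
      · have := eX.injective (Fin.ext h)
        rw [this]
    · by_cases h₁ : PX x <;> simp [f, h₁] at h
      have := (eX x).2
      omega
    · by_cases h₁ : PX x' <;> simp [f, h₁] at h
      have := (eX x').2
      omega
    · simpa [f] using h
  have hg : Function.Injective g := by
    rintro (x | m) (x' | m') h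
    · by_cases h₁ : PY x <;> by_cases h₂ : PY x' <;> simp [g, h₁, h₂] at h
      · simpa using ht h
      · have := eY.injective (Fin.ext h)
        rw [this]
    · by_cases h₁ : PY x <;> simp [g, h₁] at h
      have := (eY x).2
      omega
    · by_cases h₁ : PY x' <;> simp [g, h₁] at h
      have := (eY x').2
      omega
    · simpa [g] using h
  let S : X ⊕ ℕ → Y ⊕ ℕ → Prop := fun a c => match a, c with
    | .inl x, .inl y => R x y
    | .inl x, .inr _ => ¬ PX x
    | .inr _, .inl y => ¬ PY y
    | .inr _, .inr _ => True
  obtain ⟨h, hbij, hS⟩ := Function.Embedding.schroeder_bernstein_of_rel hf hg S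
    (by
      rintro (x | m)
      · by_cases h₁ : PX x
        · simpa [f, h₁, S] using hsR ⟨x, h₁⟩
        · simp [f, h₁, S]
      · simp [f, S])
    (by
      rintro (y | m)
      · by_cases h₁ : PY y
        · simpa [g, h₁, S] using htR ⟨y, h₁⟩
        · simp [g, h₁, S]
      · simp [g, S])
  let e := Equiv.ofBijective h hbij
  have he : ∀ a, S a (e a) := hS
  refine ⟨⟨fun x => (e (.inl x)).getLeft?, fun y => (e.symm (.inl y)).getLeft?, ?_⟩, ?_, ?_, ?_⟩
  · intro x y
    simp only [Sum.getLeft?_eq_some_iff]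
    rw [Equiv.symm_apply_eq, eq_comm]
  · intro x hx
    have := he (.inl x)
    rcases hc : e (.inl x) with y | m
    · exact ⟨y, Sum.getLeft?_eq_some_iff.2 hc⟩
    · rw [hc] at this
      exact absurd hx this
  · intro y hy
    obtain ⟨a, ha⟩ := e.surjective (.inl y)
    have := he a
    rw [ha] at this
    rcases a with x | m
    · exact ⟨x, Sum.getLeft?_eq_some_iff.2 ha⟩
    · exact absurd hy this
  · intro x y hxy
    have hc : e (.inl x) = .inl y := Sum.getLeft?_eq_some_iff.1 hxy
    have := he (.inl x)
    rwa [hc] at this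

/-! ### The marriage condition from the ranks of coefficient matrices -/

/-- The closed intervals `[b, d]` and `[b', d']` have endpoints at distance at most `δ`. -/
def EndpointsClose (δ b d b' d' : ℕ) : Prop :=
  (b' ≤ b + δ ∧ d ≤ d' + δ) ∧ (b ≤ b' + δ ∧ d' ≤ d + δ)

/-- The pointwise coefficients of a morphism `⨁ₓ 𝕀[b x, d x] ⟶ (⨁ᵧ 𝕀[b' y, d' y])(δ)`: the number
`F p y x` is the coefficient at the vertex `p` from the summand `x` to the summand `y`. The second
condition is naturality. -/
structure IsCoefficient {k X Y : Type*} [Zero k] (δ : ℕ) (b d : X → ℕ) (b' d' : Y → ℕ)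
    (F : ℕ → Y → X → k) : Prop where
  support : ∀ p y x, F p y x ≠ 0 → (b x ≤ p ∧ p ≤ d x) ∧ b' y ≤ p + δ ∧ p + δ ≤ d' y
  natural : ∀ p p' y x, p ≤ p' → b x ≤ p → p ≤ d x → b' y ≤ p' + δ → p' + δ ≤ d' y →
    F p y x = F p' y x

section Coefficients

variable {k X Y : Type*} [Field k] {δ : ℕ} {b d : X → ℕ} {b' d' : Y → ℕ} {F : ℕ → Y → X → k}

/-- A nonzero morphism `𝕀[b, d] ⟶ 𝕀[b', d'](δ)` forces `b' ≤ b + δ ≤ d' ≤ d + δ`. -/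
lemma IsCoefficient.le (hF : IsCoefficient δ b d b' d' F) {y : Y} {x : X} (h : F (b x) y x ≠ 0) :
    b' y ≤ b x + δ ∧ b x + δ ≤ d' y ∧ d' y ≤ d x + δ := by
  obtain ⟨⟨h₁, h₂⟩, h₃, h₄⟩ := hF.support _ _ _ h
  have e := hF.natural (b x) (d' y - δ) y x (by omega) h₁ h₂ (by omega) (by omega)
  rw [e] at h
  obtain ⟨⟨h₅, h₆⟩, -⟩ := hF.support _ _ _ h
  omega

/-- Bjerkevik's argument: the bars of length at least `2δ` can be injectively assigned `δ`-close
bars on the other side. For a set `A` of long bars with set `N` of neighbours, the coefficient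
matrices `A → N → A` compose to a matrix that is unitriangular with respect to the order of the
midpoints of the bars, because an intermediate bar that is close to neither end of a composite
`x → y → x'` would force the midpoint of `x'` to be smaller than that of `x`. Hence `|A| ≤ |N|`, and
Hall's marriage theorem applies. -/
lemma exists_injective_endpointsClose [Fintype X] [Fintype Y] [DecidableEq X]
    {G : ℕ → X → Y → k}
    (hF : IsCoefficient δ b d b' d' F) (hG : IsCoefficient δ b' d' b d G)
    (hGF : ∀ p x x', b x ≤ p → p ≤ d x → b x' ≤ p + δ + δ → p + δ + δ ≤ d x' →
      ∑ y, G (p + δ) x' y * F p y x = if x = x' then 1 else 0) :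
    ∃ s : {x // b x + 2 * δ ≤ d x} → Y, Function.Injective s ∧
      ∀ x, EndpointsClose δ (b x.1) (d x.1) (b' (s x)) (d' (s x)) := by
  classical
  let W : Y → X → k := fun y x => F (b x) y x
  let V : X → Y → k := fun x y => G (b' y) x y
  have hprod : ∀ x x', b x + 2 * δ ≤ d x → b x' + 2 * δ ≤ d x' → b x + d x ≤ b x' + d x' →
      ∑ y, V x' y * W y x = if x = x' then 1 else 0 := by
    intro x x' hx hx' hle
    by_cases hc : b x' ≤ b x + δ + δ ∧ b x + δ + δ ≤ d x'
    · rw [← hGF (b x) x x' le_rfl (by omega) hc.1 hc.2]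
      refine Finset.sum_congr rfl fun y _ => ?_
      by_cases hW : W y x = 0
      · have : F (b x) y x = 0 := hW
        rw [hW, this, mul_zero, mul_zero]
      · obtain ⟨h₁, h₂, h₃⟩ := hF.le hW
        rw [show V x' y = G (b x + δ) x' y from
          hG.natural (b' y) (b x + δ) x' y h₁ le_rfl (by omega) hc.1 hc.2]
    · -- The composite is invisible because `b x + 2δ` lies outside `[b x', d x']`. A nonzero
      -- product would put it to the right of `d x'`, and the length of `x'` would then force its
      -- midpoint below that of `x`.
      have hne : x ≠ x' := by
        rintro rfl
        omega
      rw [if_neg hne]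
      refine Finset.sum_eq_zero fun y _ => ?_
      by_contra hne'
      obtain ⟨h₁, h₂, h₃⟩ := hF.le (right_ne_zero_of_mul hne')
      obtain ⟨h₄, h₅, h₆⟩ := hG.le (left_ne_zero_of_mul hne')
      omega
  let t : {x // b x + 2 * δ ≤ d x} → Finset Y := fun x =>
    Finset.univ.filter fun y => EndpointsClose δ (b x.1) (d x.1) (b' y) (d' y)
  obtain ⟨s, hs, hst⟩ := (Finset.all_card_le_biUnion_card_iff_exists_injective t).1 fun A => by
    set N := A.biUnion t with hN
    have hmem : ∀ x ∈ A, ∀ y, EndpointsClose δ (b x.1) (d x.1) (b' y) (d' y) → y ∈ N :=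
      fun x hx y hy => Finset.mem_biUnion.2 ⟨x, hx, by simpa [t] using hy⟩
    have hsum : ∀ x x' : A, b x.1.1 + d x.1.1 ≤ b x'.1.1 + d x'.1.1 →
        ∑ y : N, V x'.1.1 y * W y x.1.1 = if x = x' then 1 else 0 := by
      intro x x' hle
      have h := hprod x.1.1 x'.1.1 x.1.2 x'.1.2 hle
      have h' : (if x.1.1 = x'.1.1 then (1 : k) else 0) = if x = x' then 1 else 0 := by
        simp only [Subtype.ext_iff]
      rw [← h', ← h, Finset.sum_coe_sort N (fun y => V x'.1.1 y * W y x.1.1)]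
      refine Finset.sum_subset (Finset.subset_univ _) fun y _ hy => ?_
      by_contra hne
      obtain ⟨h₁, h₂, h₃⟩ := hF.le (right_ne_zero_of_mul hne)
      obtain ⟨h₄, h₅, h₆⟩ := hG.le (left_ne_zero_of_mul hne)
      have c₁ : ¬ EndpointsClose δ _ _ _ _ := fun hy' => hy (hmem x.1 x.2 y hy')
      have c₂ : ¬ EndpointsClose δ _ _ _ _ := fun hy' => hy (hmem x'.1 x'.2 y hy')
      unfold EndpointsClose at c₁ c₂
      have hx := x.1.2
      have hx' := x'.1.2
      omega
    let Q : (A → k) →ₗ[k] (N → k) := Matrix.mulVecLin (Matrix.of fun y x => W y.1 x.1.1)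
    have hQ : Function.Injective Q := by
      rw [← LinearMap.ker_eq_bot, LinearMap.ker_eq_bot']
      intro v hv
      by_contra hne
      obtain ⟨x₀, hx₀⟩ := Function.ne_iff.1 hne
      -- The coordinate of `V * W * v` at a bar of maximal midpoint in the support of `v` is the
      -- coordinate of `v` itself.
      obtain ⟨x', hx', hmax⟩ := Finset.exists_max_image
        (Finset.univ.filter fun x : A => v x ≠ 0) (fun x => b x.1.1 + d x.1.1)
        ⟨x₀, by simpa using hx₀⟩
      simp only [Finset.mem_filter, Finset.mem_univ, true_and] at hx' hmax
      apply hx'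
      have h0 : ∑ y : N, V x'.1.1 y * Q v y = 0 := by simp [hv]
      have h1 : ∑ y : N, V x'.1.1 y * Q v y =
          ∑ x : A, (∑ y : N, V x'.1.1 y * W y x.1.1) * v x := by
        simp only [Q, Matrix.mulVecLin_apply, Matrix.mulVec, dotProduct, Matrix.of_apply,
          Finset.mul_sum, Finset.sum_mul]
        rw [Finset.sum_comm]
        simp only [mul_assoc]
      have h2 : ∀ x : A, (∑ y : N, V x'.1.1 y * W y x.1.1) * v x =
          if x = x' then v x' else 0 := by
        intro x
        by_cases hx : v x = 0
        · rw [hx, mul_zero]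
          split_ifs with h
          · rw [← h, hx]
          · rfl
        · rw [hsum x x' (hmax x hx)]
          split_ifs with h
          · rw [h, one_mul]
          · rw [zero_mul]
      rw [← h0, h1, Finset.sum_congr rfl fun x _ => h2 x]
      simp
    simpa using LinearMap.finrank_le_finrank_of_injective hQ
  exact ⟨s, hs, fun x => by simpa [t] using hst x⟩

end Coefficients

open CategoryTheory CategoryTheory.Limits

/-! ### Interval decompositions -/

section Preadditive

variable {C : Type*} [Category* C] [Preadditive C]

/-- A complete system of orthogonal inclusions and projections identifies an object with a
biproduct. -/
lemma nonempty_iso_biproduct {J : Type} [Fintype J] (f : J → C) [HasBiproduct f] (M : C)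
    (i : ∀ j, f j ⟶ M) (p : ∀ j, M ⟶ f j) (h₁ : ∀ j, i j ≫ p j = 𝟙 _)
    (h₂ : ∀ j j', j ≠ j' → i j ≫ p j' = 0) (h : ∑ j, p j ≫ i j = 𝟙 M) :
    Nonempty (M ≅ ⨁ f) := by
  let c : Bicone f :=
    { pt := M
      π := p
      ι := i
      ι_π := fun j j' => by
        split_ifs with hj
        · subst hj
          simpa using h₁ j
        · exact h₂ j j' hj }
  exact ⟨biproduct.uniqueUpToIso f (b := c) (isBilimitOfTotal c h)⟩

/-- The complement of a retract is the kernel of the retraction. -/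
lemma nonempty_iso_biproduct_option {J : Type} [Fintype J] (f : Option J → C) [HasBiproduct f]
    [HasBiproduct fun j => f (some j)] {M : C} (i : f none ⟶ M) (r : M ⟶ f none) [HasKernel r]
    (hir : i ≫ r = 𝟙 _) (e : kernel r ≅ ⨁ fun j => f (some j)) : Nonempty (M ≅ ⨁ f) := by
  let π : M ⟶ kernel r := kernel.lift r (𝟙 M - r ≫ i) (by simp [hir])
  have hπ : π ≫ kernel.ι r = 𝟙 M - r ≫ i := kernel.lift_ι _ _ _
  have hιπ : kernel.ι r ≫ π = 𝟙 _ := by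
    rw [← cancel_mono (kernel.ι r), Category.assoc, hπ]
    simp
  have hiπ : i ≫ π = 0 := by
    rw [← cancel_mono (kernel.ι r), Category.assoc, hπ]
    simp [reassoc_of% hir]
  refine nonempty_iso_biproduct f M
    (fun o => match o with
      | none => i
      | some j => biproduct.ι (fun j => f (some j)) j ≫ e.inv ≫ kernel.ι r)
    (fun o => match o with
      | none => r
      | some j => π ≫ e.hom ≫ biproduct.π (fun j => f (some j)) j) ?_ ?_ ?_
  · rintro (_ | j)
    · exact hir
    · simp [reassoc_of% hιπ]
  · rintro (_ | j) (_ | j') hj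
    · exact absurd rfl hj
    · simp [reassoc_of% hiπ]
    · simp
    · have hne : j ≠ j' := fun h => hj (congr_arg some h)
      simp [reassoc_of% hιπ, biproduct.ι_π_ne _ hne]
  · have hs : ∑ j, (π ≫ e.hom ≫ biproduct.π (fun j => f (some j)) j) ≫
        biproduct.ι (fun j => f (some j)) j ≫ e.inv ≫ kernel.ι r = π ≫ kernel.ι r := by
      have ht : π ≫ e.hom ≫ (∑ j, biproduct.π (fun j => f (some j)) j ≫
          biproduct.ι (fun j => f (some j)) j) ≫ e.inv ≫ kernel.ι r = π ≫ kernel.ι r := by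
        rw [biproduct.total, Category.id_comp, Iso.hom_inv_id_assoc]
      simpa only [Preadditive.sum_comp, Preadditive.comp_sum, Category.assoc] using ht
    rw [Fintype.sum_option]
    simp only [hs, hπ]
    abel

/-- Equal families have isomorphic biproducts. -/
lemma nonempty_iso_biproduct_of_eq {J : Type} [Fintype J] {f g : J → C} [HasBiproduct f]
    [HasBiproduct g] (h : f = g) {M : C} (e : M ≅ ⨁ f) : Nonempty (M ≅ ⨁ g) := by
  subst h
  exact ⟨e⟩

end Preadditive

section Decomposition

variable {k : Type u} [Field k] {n : ℕ}

namespace Interval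

lemma birth_le_death (I : Interval n) : I.birth ≤ I.death := I.2

open scoped Classical in
/-- The component at `p` of the morphism `𝕀[b,d] ⟶ M` given by a vector of `M_b`. -/
noncomputable def homFromAt {M : Fin n ⥤ FGModuleCat.{u} k} (I : Interval n)
    (a : FGModuleCat.of k k ⟶ M.obj I.birth) (p : Fin n) : I.repObj k p ⟶ M.obj p :=
  if h : I.Contains p then (I.repObjIso k p h).hom ≫ a ≫ M.map (homOfLE h.1) else 0

/-- The morphism `𝕀[b,d] ⟶ M` given by a vector of `M_b` that dies after `d`. -/
noncomputable def homFrom {M : Fin n ⥤ FGModuleCat.{u} k} (I : Interval n)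
    (a : FGModuleCat.of k k ⟶ M.obj I.birth)
    (ha : ∀ (q : Fin n) (h : I.birth ≤ q), I.death < q → a ≫ M.map (homOfLE h) = 0) :
    I.rep k ⟶ M where
  app p := I.homFromAt a p
  naturality p q f := by
    change I.repMap k p q ≫ I.homFromAt a q = I.homFromAt a p ≫ M.map f
    have hpq : p ≤ q := f.le
    by_cases hp : I.Contains p
    · have e : M.map (homOfLE hp.1) ≫ M.map f = M.map (homOfLE (hp.1.trans hpq)) := by
        rw [← Functor.map_comp]
        rfl
      by_cases hq : I.Contains q
      · simp only [repMap, homFromAt, hp, hq, and_self, dif_pos, Category.assoc,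
          Iso.inv_hom_id_assoc, e]
      · have hd : I.death < q := lt_of_not_ge fun h => hq ⟨hp.1.trans hpq, h⟩
        simp only [homFromAt, hp, hq, dif_pos, dif_neg, not_false_iff, Category.assoc, comp_zero, e,
          ha q (hp.1.trans hpq) hd]
    · exact (I.isZero_repObj k p hp).eq_of_src _ _

open scoped Classical in
/-- The component at `p` of the morphism `M ⟶ 𝕀[b,d]` given by a linear form on `M_d`. -/
noncomputable def homToAt {M : Fin n ⥤ FGModuleCat.{u} k} (I : Interval n)
    (c : M.obj I.death ⟶ FGModuleCat.of k k) (p : Fin n) : M.obj p ⟶ I.repObj k p :=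
  if h : I.Contains p then M.map (homOfLE h.2) ≫ c ≫ (I.repObjIso k p h).inv else 0

/-- The morphism `M ⟶ 𝕀[b,d]` given by a linear form on `M_d` that vanishes on everything born
before `b`. -/
noncomputable def homTo {M : Fin n ⥤ FGModuleCat.{u} k} (I : Interval n)
    (c : M.obj I.death ⟶ FGModuleCat.of k k)
    (hc : ∀ (q : Fin n) (h : q ≤ I.death), q < I.birth → M.map (homOfLE h) ≫ c = 0) :
    M ⟶ I.rep k where
  app p := I.homToAt c p
  naturality p q f := by
    change M.map f ≫ I.homToAt c q = I.homToAt c p ≫ I.repMap k p q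
    have hpq : p ≤ q := f.le
    by_cases hq : I.Contains q
    · have e : M.map f ≫ M.map (homOfLE hq.2) = M.map (homOfLE (hpq.trans hq.2)) := by
        rw [← Functor.map_comp]
        rfl
      by_cases hp : I.Contains p
      · simp only [repMap, homToAt, hp, hq, and_self, dif_pos, Category.assoc,
          Iso.inv_hom_id_assoc, reassoc_of% e]
      · have hd : p < I.birth := lt_of_not_ge fun h => hp ⟨h, hpq.trans hq.2⟩
        simp only [homToAt, hp, hq, dif_pos, dif_neg, not_false_iff, zero_comp, reassoc_of% e,
          reassoc_of% (hc p (hpq.trans hq.2) hd)]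
    · exact (I.isZero_repObj k q hq).eq_of_tgt _ _

lemma homFrom_comp_homTo {M : Fin n ⥤ FGModuleCat.{u} k} (I : Interval n)
    (a : FGModuleCat.of k k ⟶ M.obj I.birth)
    (ha : ∀ (q : Fin n) (h : I.birth ≤ q), I.death < q → a ≫ M.map (homOfLE h) = 0)
    (c : M.obj I.death ⟶ FGModuleCat.of k k)
    (hc : ∀ (q : Fin n) (h : q ≤ I.death), q < I.birth → M.map (homOfLE h) ≫ c = 0)
    (hac : a ≫ M.map (homOfLE I.birth_le_death) ≫ c = 𝟙 _) :
    I.homFrom a ha ≫ I.homTo c hc = 𝟙 _ := by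
  ext p : 2
  change I.homFromAt a p ≫ I.homToAt c p = 𝟙 (I.repObj k p)
  by_cases hp : I.Contains p
  · have e : M.map (homOfLE hp.1) ≫ M.map (homOfLE hp.2) = M.map (homOfLE I.birth_le_death) := by
      rw [← Functor.map_comp]
      rfl
    simp only [homFromAt, homToAt, hp, dif_pos, Category.assoc, reassoc_of% e, reassoc_of% hac,
      Iso.hom_inv_id]
  · exact (I.isZero_repObj k p hp).eq_of_src _ _

end Interval

/-- A nonzero linear map can be extended to a factorization of the identity of `k`. -/
lemma exists_comp_eq_id_of_ne_zero {V W : FGModuleCat.{u} k} (f : V ⟶ W) (hf : f ≠ 0) :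
    ∃ (a : FGModuleCat.of k k ⟶ V) (c : W ⟶ FGModuleCat.of k k), a ≫ f ≫ c = 𝟙 _ := by
  have hf' : f.hom.hom ≠ 0 := fun h => hf (FGModuleCat.hom_ext h)
  obtain ⟨v, hv⟩ : ∃ v, f.hom.hom v ≠ 0 := by
    by_contra! h
    exact hf' (LinearMap.ext h)
  obtain ⟨φ, hφ⟩ : ∃ φ : Module.Dual k W, φ (f.hom.hom v) = 1 := by
    obtain ⟨φ, hφ⟩ := Module.Projective.exists_dual_ne_zero k hv
    exact ⟨(φ (f.hom.hom v))⁻¹ • φ, by simp [hφ]⟩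
  refine ⟨FGModuleCat.ofHom (LinearMap.toSpanSingleton k V v), FGModuleCat.ofHom φ, ?_⟩
  ext
  change φ (f.hom.hom ((1 : k) • v)) = 1
  rw [one_smul, hφ]

/-- A nonzero persistence module has an interval representation as a retract: take an interval
`[b, d]` of maximal length such that `M_b ⟶ M_d` is nonzero. -/
lemma exists_interval_retract (M : Fin n ⥤ FGModuleCat.{u} k) (hM : ¬ IsZero M) :
    ∃ (I : Interval n) (i : I.rep k ⟶ M) (r : M ⟶ I.rep k), i ≫ r = 𝟙 _ := by
  classical
  let S : Finset (Interval n) := Finset.univ.filter fun I => M.map (homOfLE I.birth_le_death) ≠ 0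
  have hS : S.Nonempty := by
    by_contra h
    refine hM (Functor.isZero _ fun x => ?_)
    rw [Finset.not_nonempty_iff_eq_empty] at h
    have hx : (⟨(x, x), le_rfl⟩ : Interval n) ∉ S := h ▸ Finset.notMem_empty _
    simp only [S, Finset.mem_filter, Finset.mem_univ, true_and, not_not] at hx
    rw [IsZero.iff_id_eq_zero, ← M.map_id]
    exact hx
  obtain ⟨I, hI, hmax⟩ := S.exists_max_image (fun I => (I.death : ℕ) - I.birth) hS
  simp only [S, Finset.mem_filter, Finset.mem_univ, true_and] at hI hmax
  obtain ⟨a, c, hac⟩ := exists_comp_eq_id_of_ne_zero _ hI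
  have hbd : (I.birth : ℕ) ≤ I.death := I.2
  refine ⟨I, I.homFrom a fun q h hq => ?_, I.homTo c fun q h hq => ?_,
    I.homFrom_comp_homTo a _ c _ hac⟩
  · by_contra hne
    have h1 := hmax ⟨(I.birth, q), h⟩ fun h0 => hne <| by
      have h0 : M.map (homOfLE h) = 0 := h0
      rw [h0, comp_zero]
    have h2 : (I.death : ℕ) < q := hq
    change (q : ℕ) - I.birth ≤ I.death - I.birth at h1
    omega
  · by_contra hne
    have h1 := hmax ⟨(q, I.death), h⟩ fun h0 => hne <| by
      have h0 : M.map (homOfLE h) = 0 := h0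
      rw [h0, zero_comp]
    have h2 : (q : ℕ) < I.birth := hq
    change (I.death : ℕ) - q ≤ I.death - I.birth at h1
    omega

/-- The total dimension of a persistence module. -/
noncomputable def totalDim (M : Fin n ⥤ FGModuleCat.{u} k) : ℕ :=
  ∑ p, Module.finrank k (M.obj p)

lemma totalDim_kernel_lt {M : Fin n ⥤ FGModuleCat.{u} k} {I : Interval n} {i : I.rep k ⟶ M}
    {r : M ⟶ I.rep k} (h : i ≫ r = 𝟙 _) : totalDim (kernel r) < totalDim M := by
  have hmono : ∀ p, Function.Injective ((kernel.ι r).app p).hom.hom := fun p => by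
    have : Mono ((kernel.ι r).app p) := inferInstance
    have h' : Mono ((forget₂ (FGModuleCat.{u} k) (ModuleCat.{u} k)).map ((kernel.ι r).app p)) :=
      inferInstance
    exact (ModuleCat.mono_iff_injective _).1 h'
  refine Finset.sum_lt_sum (fun p _ => LinearMap.finrank_le_finrank_of_injective (hmono p))
    ⟨I.birth, Finset.mem_univ _, ?_⟩
  have hb : I.Contains I.birth := ⟨le_rfl, I.2⟩
  refine lt_of_le_of_ne (LinearMap.finrank_le_finrank_of_injective (hmono _)) fun heq => ?_
  have hsurj := (LinearMap.injective_iff_surjective_of_finrank_eq_finrank heq).1 (hmono I.birth)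
  have hr : r.app I.birth = 0 := by
    ext m
    obtain ⟨z, rfl⟩ := hsurj m
    have := congr_arg (fun f : kernel r ⟶ I.rep k => (f.app I.birth).hom.hom z)
      (kernel.condition r)
    exact this
  have h1 : 𝟙 (FGModuleCat.of k k) = 0 := by
    have h2 := congr_app h I.birth
    rw [NatTrans.comp_app, hr, comp_zero] at h2
    have h3 : 𝟙 (I.repObj k I.birth) = 0 := h2.symm
    rw [← Iso.inv_hom_id (I.repObjIso k _ hb), ← Category.id_comp (I.repObjIso k _ hb).hom, h3,
      zero_comp, comp_zero]
  have h4 := congr_arg (fun f => f.hom.hom (1 : k)) h1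
  exact one_ne_zero (α := k) h4

/-- Every persistence module is a finite direct sum of interval representations: split off a retract
and argue by induction on the total dimension. -/
lemma exists_interval_decomposition (M : Fin n ⥤ FGModuleCat.{u} k) :
    ∃ (ι : Type) (_ : Fintype ι) (J : ι → Interval n), Nonempty (M ≅ ⨁ fun j => (J j).rep k) := by
  induction hd : totalDim M using Nat.strong_induction_on generalizing M with
  | _ d ih =>
    by_cases hM : IsZero M
    · refine ⟨Empty, inferInstance, Empty.elim, nonempty_iso_biproduct _ M (fun j => j.elim)
        (fun j => j.elim) (fun j => j.elim) (fun j => j.elim) (hM.eq_of_src _ _)⟩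
    · obtain ⟨I, i, r, hir⟩ := exists_interval_retract M hM
      obtain ⟨ι, _, J, ⟨e⟩⟩ := ih _ (hd ▸ totalDim_kernel_lt hir) (kernel r) rfl
      exact ⟨Option ι, inferInstance, fun o => o.elim I J,
        nonempty_iso_biproduct_option (fun o : Option ι => Interval.rep k (o.elim I J)) i r hir e⟩

/-- Every persistence module has a barcode. -/
lemma exists_isBarcode (M : Fin n ⥤ FGModuleCat.{u} k) : ∃ B, IsBarcode M B := by
  classical
  obtain ⟨ι, _, J, ⟨e⟩⟩ := exists_interval_decomposition M
  let B : Barcode n := fun I => Fintype.card {j // J j = I}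
  let s : B.Bar ≃ ι :=
    (Equiv.sigmaCongrRight fun I => (Fintype.equivFin {j // J j = I}).symm).trans
      (Equiv.sigmaFiberEquiv J)
  have hs : ∀ x : B.Bar, J (s x) = x.1 := fun x =>
    ((Fintype.equivFin {j // J j = x.1}).symm x.2).2
  have hJ : (fun x : B.Bar => (J (s x)).rep k) = fun x => x.1.rep k :=
    funext fun x => by rw [hs x]
  exact ⟨B, nonempty_iso_biproduct_of_eq hJ
    (e ≪≫ (biproduct.reindex s fun j => (J j).rep k).symm)⟩

lemma isBarcode_barcode (M : Fin n ⥤ FGModuleCat.{u} k) : IsBarcode M (barcode M) := by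
  rw [barcode, dif_pos (exists_isBarcode M)]
  exact (exists_isBarcode M).choose_spec

end Decomposition

/-! ### Interval bases and coefficients of morphisms -/

section Coefficient

variable {k : Type u} [Field k] {n : ℕ}

namespace Interval

open scoped Classical in
/-- The generator of `𝕀[b,d]_p`, with value `0` if the interval does not contain `p`. -/
noncomputable def repGen (k : Type u) [Field k] (I : Interval n) (p : Fin n) :
    FGModuleCat.of k k ⟶ (I.rep k).obj p :=
  if h : I.Contains p then (I.repObjIso k p h).inv else 0

open scoped Classical in
/-- The coordinate on `𝕀[b,d]_p` dual to the generator, with value `0` if the interval does not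
contain `p`. -/
noncomputable def repCoord (k : Type u) [Field k] (I : Interval n) (p : Fin n) :
    (I.rep k).obj p ⟶ FGModuleCat.of k k :=
  if h : I.Contains p then (I.repObjIso k p h).hom else 0

lemma repGen_of_contains {I : Interval n} {p : Fin n} (h : I.Contains p) :
    I.repGen k p = (I.repObjIso k p h).inv := dif_pos h

lemma repCoord_of_contains {I : Interval n} {p : Fin n} (h : I.Contains p) :
    I.repCoord k p = (I.repObjIso k p h).hom := dif_pos h

lemma repGen_of_not_contains {I : Interval n} {p : Fin n} (h : ¬ I.Contains p) :
    I.repGen k p = 0 := dif_neg h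

lemma repCoord_of_not_contains {I : Interval n} {p : Fin n} (h : ¬ I.Contains p) :
    I.repCoord k p = 0 := dif_neg h

lemma repGen_repCoord {I : Interval n} {p : Fin n} (h : I.Contains p) :
    I.repGen k p ≫ I.repCoord k p = 𝟙 _ := by
  rw [repGen_of_contains h, repCoord_of_contains h]
  exact Iso.inv_hom_id _

lemma repCoord_repGen (I : Interval n) (p : Fin n) :
    I.repCoord k p ≫ I.repGen k p = 𝟙 _ := by
  by_cases h : I.Contains p
  · rw [repGen_of_contains h, repCoord_of_contains h]
    exact Iso.hom_inv_id _
  · exact (I.isZero_repObj k p h).eq_of_src _ _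

lemma repGen_map {I : Interval n} {p q : Fin n} (h : I.Contains p) (f : p ⟶ q) :
    I.repGen k p ≫ (I.rep k).map f = I.repGen k q := by
  by_cases hq : I.Contains q
  · rw [repGen_of_contains h, repGen_of_contains hq]
    change (I.repObjIso k p h).inv ≫ I.repMap k p q = _
    rw [repMap, dif_pos ⟨h, hq⟩, Iso.inv_hom_id_assoc]
  · exact (I.isZero_repObj k q hq).eq_of_tgt _ _

lemma map_repCoord {I : Interval n} {p q : Fin n} (h : I.Contains q) (f : p ⟶ q) :
    (I.rep k).map f ≫ I.repCoord k q = I.repCoord k p := by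
  by_cases hp : I.Contains p
  · rw [repCoord_of_contains h, repCoord_of_contains hp]
    change I.repMap k p q ≫ (I.repObjIso k q h).hom = _
    rw [repMap, dif_pos ⟨hp, h⟩, Category.assoc, Iso.inv_hom_id, Category.comp_id]
  · exact (I.isZero_repObj k p hp).eq_of_src _ _

end Interval

/-- An interval basis of `M` with barcode `B`: for every bar and every vertex, a vector of `M` at
this vertex and a coordinate, which vanish when the bar does not contain the vertex and are
compatible with the structure maps otherwise, such that the nonzero vectors at a vertex are a basis
with dual basis given by the coordinates. Vectors of `V` are encoded as morphisms `k ⟶ V`. -/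
structure IntervalBasis (M : Fin n ⥤ FGModuleCat.{u} k) (B : Barcode n) where
  /-- The basis vectors. -/
  vec : B.Bar → ∀ p, FGModuleCat.of k k ⟶ M.obj p
  /-- The coordinates. -/
  coord : B.Bar → ∀ p, M.obj p ⟶ FGModuleCat.of k k
  vec_eq_zero {x : B.Bar} {p : Fin n} : ¬ x.1.Contains p → vec x p = 0
  coord_eq_zero {x : B.Bar} {p : Fin n} : ¬ x.1.Contains p → coord x p = 0
  vec_coord_self {x : B.Bar} {p : Fin n} : x.1.Contains p → vec x p ≫ coord x p = 𝟙 _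
  vec_coord_of_ne {x y : B.Bar} (p : Fin n) : x ≠ y → vec x p ≫ coord y p = 0
  total (p : Fin n) : ∑ x, coord x p ≫ vec x p = 𝟙 (M.obj p)
  vec_map {x : B.Bar} {p q : Fin n} (f : p ⟶ q) : x.1.Contains p → vec x p ≫ M.map f = vec x q
  map_coord {x : B.Bar} {p q : Fin n} (f : p ⟶ q) :
    x.1.Contains q → M.map f ≫ coord x q = coord x p

lemma IsBarcode.nonempty_intervalBasis {M : Fin n ⥤ FGModuleCat.{u} k} {B : Barcode n}
    (h : IsBarcode M B) : Nonempty (IntervalBasis M B) := by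
  obtain ⟨e⟩ := h
  let i : ∀ x : B.Bar, x.1.rep k ⟶ M := fun x =>
    biproduct.ι (fun x : B.Bar => x.1.rep k) x ≫ e.inv
  let r : ∀ x : B.Bar, M ⟶ x.1.rep k := fun x =>
    e.hom ≫ biproduct.π (fun x : B.Bar => x.1.rep k) x
  have hself : ∀ x, i x ≫ r x = 𝟙 _ := fun x => by simp [i, r]
  have hne : ∀ x y, x ≠ y → i x ≫ r y = 0 := fun x y hxy => by
    simp [i, r, biproduct.ι_π_ne _ hxy]
  have htot : ∑ x, r x ≫ i x = 𝟙 M := by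
    have ht : e.hom ≫ (∑ x, biproduct.π (fun x : B.Bar => x.1.rep k) x ≫
        biproduct.ι (fun x : B.Bar => x.1.rep k) x) ≫ e.inv = 𝟙 M := by
      have := biproduct.total (f := fun x : B.Bar => x.1.rep k)
      refine (congr_arg (fun z => e.hom ≫ z ≫ e.inv) this).trans ?_
      rw [Category.id_comp, Iso.hom_inv_id]
    simpa only [Preadditive.sum_comp, Preadditive.comp_sum, Category.assoc, i, r] using ht
  clear_value i r
  exact ⟨
    { vec := fun x p => x.1.repGen k p ≫ (i x).app p
      coord := fun x p => (r x).app p ≫ x.1.repCoord k p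
      vec_eq_zero := fun h => by rw [Interval.repGen_of_not_contains h, zero_comp]
      coord_eq_zero := fun h => by rw [Interval.repCoord_of_not_contains h, comp_zero]
      vec_coord_self := fun {x p} h => by
        have h' := congr_app (hself x) p
        rw [NatTrans.comp_app, NatTrans.id_app] at h'
        rw [Category.assoc, reassoc_of% h', Interval.repGen_repCoord h]
      vec_coord_of_ne := fun {x y} p h => by
        have h' := congr_app (hne x y h) p
        rw [NatTrans.comp_app, NatTrans.app_zero] at h'
        rw [Category.assoc, reassoc_of% h', zero_comp, comp_zero]
      total := fun p => by
        have h' := congr_app htot p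
        rw [NatTrans.app_sum, NatTrans.id_app] at h'
        rw [← h']
        refine Finset.sum_congr rfl fun x _ => ?_
        rw [NatTrans.comp_app, Category.assoc, reassoc_of% (x.1.repCoord_repGen (k := k) p)]
      vec_map := fun {x p q} f h => by
        rw [Category.assoc, ← (i x).naturality, reassoc_of% (Interval.repGen_map (k := k) h f)]
      map_coord := fun {x p q} f h => by
        rw [(r x).naturality_assoc, Interval.map_repCoord h] }⟩

/-- The scalar of an endomorphism of the vector space `k`. -/
def scalar (f : FGModuleCat.of k k ⟶ FGModuleCat.of k k) : k := f.hom.hom (1 : k)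

lemma scalar_zero : scalar (0 : FGModuleCat.of k k ⟶ FGModuleCat.of k k) = 0 := rfl

lemma scalar_id : scalar (𝟙 (FGModuleCat.of k k)) = 1 := rfl

lemma scalar_comp (f g : FGModuleCat.of k k ⟶ FGModuleCat.of k k) :
    scalar (f ≫ g) = scalar g * scalar f := by
  change g.hom.hom (f.hom.hom (1 : k)) = g.hom.hom (1 : k) * f.hom.hom (1 : k)
  have := g.hom.hom.map_smul (f.hom.hom (1 : k)) (1 : k)
  rw [smul_eq_mul, mul_one] at this
  rw [mul_comm]
  exact this

lemma scalar_sum {ι : Type*} (s : Finset ι)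
    (f : ι → (FGModuleCat.of k k ⟶ FGModuleCat.of k k)) :
    scalar (∑ j ∈ s, f j) = ∑ j ∈ s, scalar (f j) := by
  let φ : (FGModuleCat.of k k ⟶ FGModuleCat.of k k) →+ k :=
    { toFun := scalar, map_zero' := scalar_zero, map_add' := fun _ _ => rfl }
  exact map_sum φ f s

/-- The component `M_p ⟶ N_q`, for `q = p + δ`, of a morphism `M ⟶ N(δ)`. -/
noncomputable def componentAt {δ : ℕ} {M N : Fin n ⥤ FGModuleCat.{u} k}
    (f : M ⟶ shiftObj δ N) (p q : Fin n) (h : p.1 + δ = q.1) : M.obj p ⟶ N.obj q :=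
  f.app p ≫ (shiftObjIso δ N p q h).hom

lemma map_componentAt {δ : ℕ} {M N : Fin n ⥤ FGModuleCat.{u} k}
    (f : M ⟶ shiftObj δ N) {p q p' q' : Fin n} (h : p.1 + δ = q.1) (h' : p'.1 + δ = q'.1)
    (a : p ⟶ p') (c : q ⟶ q') :
    M.map a ≫ componentAt f p' q' h' = componentAt f p q h ≫ N.map c := by
  rw [componentAt, componentAt, f.naturality_assoc, shiftObj_map_shiftObjIso δ N a c h h',
    Category.assoc]

lemma shiftObjIso_hom (δ : ℕ) (M : Fin n ⥤ FGModuleCat.{u} k) (p : Fin n) (h : p.1 + δ < n) :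
    (shiftObjIso δ M p ⟨p.1 + δ, h⟩ rfl).hom = (shiftObjAtIso δ M p h).hom := by
  change (shiftObjAtIso δ M p h).hom ≫ M.map (𝟙 _) = _
  rw [M.map_id, Category.comp_id]

lemma shiftHomAt_shiftObjIso {δ : ℕ} {M N : Fin n ⥤ FGModuleCat.{u} k} (g : M ⟶ N)
    (p : Fin n) (h : p.1 + δ < n) :
    shiftHomAt δ g p ≫ (shiftObjIso δ N p ⟨p.1 + δ, h⟩ rfl).hom =
      (shiftObjIso δ M p ⟨p.1 + δ, h⟩ rfl).hom ≫ g.app ⟨p.1 + δ, h⟩ := by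
  rw [shiftObjIso_hom, shiftObjIso_hom, shiftHomAt, dif_pos h]
  exact (Category.assoc _ _ _).trans (congr_arg _ ((Category.assoc _ _ _).trans
    ((congr_arg _ (Iso.inv_hom_id _)).trans (Category.comp_id _))))

lemma transitionAt_shiftObjIso (δ : ℕ) (M : Fin n ⥤ FGModuleCat.{u} k) (p : Fin n)
    (h : p.1 + δ < n) (a : p ⟶ ⟨p.1 + δ, h⟩) :
    transitionAt δ M p ≫ (shiftObjIso δ M p ⟨p.1 + δ, h⟩ rfl).hom = M.map a := by
  rw [shiftObjIso_hom, transitionAt, dif_pos h]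
  exact (Category.assoc _ _ _).trans
    ((congr_arg _ (Iso.inv_hom_id _)).trans (Category.comp_id _))

/-- An interleaving identity `g(δ) ∘ f = φ_M^{2δ}` read off at a vertex. -/
lemma componentAt_comp_componentAt {δ : ℕ} {M N : Fin n ⥤ FGModuleCat.{u} k}
    (f : M ⟶ (shift _ n δ).obj N) (g : N ⟶ (shift _ n δ).obj M)
    (hfg : f ≫ (shift _ n δ).map g ≫ (shiftShiftIso δ δ M).hom = transition (δ + δ) M)
    (p q r : Fin n) (h : p.1 + δ = q.1) (h' : q.1 + δ = r.1) (a : p ⟶ r) :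
    componentAt f p q h ≫ componentAt g q r h' = M.map a := by
  have hr : p.1 + (δ + δ) < n := by have := r.2; omega
  have hq : p.1 + δ < n := by omega
  obtain rfl : q = ⟨p.1 + δ, hq⟩ := Fin.ext h.symm
  obtain rfl : r = ⟨p.1 + (δ + δ), hr⟩ := Fin.ext (by simp only at h' ⊢; omega)
  -- The four morphisms below have these types only after unfolding the shift functor; naming them
  -- makes the compositions well typed syntactically.
  obtain ⟨g', hg'⟩ : ∃ g' : N ⟶ shiftObj δ M, g' = g := ⟨_, rfl⟩
  obtain ⟨s, hs⟩ : ∃ s : (shiftObj δ N).obj p ⟶ (shiftObj δ (shiftObj δ M)).obj p,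
    s = shiftHomAt δ g' p := ⟨_, rfl⟩
  obtain ⟨t, ht⟩ : ∃ t : M.obj p ⟶ (shiftObj (δ + δ) M).obj p, t = transitionAt (δ + δ) M p :=
    ⟨_, rfl⟩
  obtain ⟨f', hf'⟩ : ∃ f' : M.obj p ⟶ (shiftObj δ N).obj p, f' = f.app p := ⟨_, rfl⟩
  have e₁ : f' ≫ s ≫ (shiftShiftIsoAt δ δ M p).hom = t := by
    subst hs ht hf' hg'
    exact congr_app hfg p
  have e₂ : s ≫ (shiftObjIso δ (shiftObj δ M) p ⟨p.1 + δ, hq⟩ rfl).hom =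
      (shiftObjIso δ N p ⟨p.1 + δ, hq⟩ rfl).hom ≫ g'.app ⟨p.1 + δ, hq⟩ := by
    subst hs
    exact shiftHomAt_shiftObjIso g' p hq
  have e₃ : t ≫ (shiftObjIso (δ + δ) M p ⟨p.1 + (δ + δ), hr⟩ rfl).hom = M.map a := by
    subst ht
    exact transitionAt_shiftObjIso (δ + δ) M p hr a
  have e₄ : (shiftShiftIsoAt δ δ M p).hom ≫
      (shiftObjIso (δ + δ) M p ⟨p.1 + (δ + δ), hr⟩ rfl).hom =
      (shiftObjIso δ (shiftObj δ M) p ⟨p.1 + δ, hq⟩ rfl).hom ≫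
        (shiftObjIso δ M ⟨p.1 + δ, hq⟩ ⟨p.1 + (δ + δ), hr⟩ h').hom := by
    rw [shiftShiftIsoAt, dif_pos hr]
    simp
  rw [← e₃, ← e₁, Category.assoc, Category.assoc, e₄, reassoc_of% e₂]
  subst hf' hg'
  exact Category.assoc _ _ _

section Matching

variable {δ : ℕ} {M N : Fin n ⥤ FGModuleCat.{u} k} {B B' : Barcode n}

/-- The coefficients at the vertices of a morphism `M ⟶ N(δ)` with respect to interval bases, with
value `0` at the numbers `p` for which `p + δ` is not a vertex. -/
noncomputable def coefficient (β : IntervalBasis M B) (β' : IntervalBasis N B')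
    (f : M ⟶ (shift _ n δ).obj N) (p : ℕ) (y : B'.Bar) (x : B.Bar) : k :=
  if h : p + δ < n then
    scalar (β.vec x ⟨p, by omega⟩ ≫ componentAt f ⟨p, by omega⟩ ⟨p + δ, h⟩ rfl ≫
      β'.coord y ⟨p + δ, h⟩)
  else 0

lemma isCoefficient_coefficient (β : IntervalBasis M B) (β' : IntervalBasis N B')
    (f : M ⟶ (shift _ n δ).obj N) :
    IsCoefficient δ (fun x : B.Bar => (x.1.birth : ℕ)) (fun x => (x.1.death : ℕ))
      (fun y : B'.Bar => (y.1.birth : ℕ)) (fun y => (y.1.death : ℕ)) (coefficient β β' f) where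
  support p y x hne := by
    by_cases h : p + δ < n
    · rw [coefficient, dif_pos h] at hne
      have hx : x.1.Contains ⟨p, by omega⟩ := by
        by_contra hx
        rw [β.vec_eq_zero hx, zero_comp, scalar_zero] at hne
        exact hne rfl
      have hy : y.1.Contains ⟨p + δ, h⟩ := by
        by_contra hy
        rw [β'.coord_eq_zero hy, comp_zero, comp_zero, scalar_zero] at hne
        exact hne rfl
      exact ⟨⟨hx.1, hx.2⟩, hy.1, hy.2⟩
    · rw [coefficient, dif_neg h] at hne
      exact absurd rfl hne
  natural p p' y x hpp' h₁ h₂ h₃ h₄ := by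
    have h' : p' + δ < n := lt_of_le_of_lt h₄ y.1.death.2
    have h : p + δ < n := by omega
    have hx : x.1.Contains ⟨p, by omega⟩ := ⟨h₁, h₂⟩
    have hy : y.1.Contains ⟨p' + δ, h'⟩ := ⟨h₃, h₄⟩
    let a : (⟨p, by omega⟩ : Fin n) ⟶ ⟨p', by omega⟩ := homOfLE hpp'
    let c : (⟨p + δ, h⟩ : Fin n) ⟶ ⟨p' + δ, h'⟩ := homOfLE (Nat.add_le_add_right hpp' δ)
    rw [coefficient, coefficient, dif_pos h, dif_pos h', ← β'.map_coord c hy, ← β.vec_map a hx,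
      Category.assoc, reassoc_of% (map_componentAt f rfl rfl a c)]

lemma sum_coefficient_mul (β : IntervalBasis M B) (β' : IntervalBasis N B')
    (f : M ⟶ (shift _ n δ).obj N) (g : N ⟶ (shift _ n δ).obj M)
    (hfg : f ≫ (shift _ n δ).map g ≫ (shiftShiftIso δ δ M).hom = transition (δ + δ) M)
    (p : ℕ) (x x' : B.Bar) (h₁ : (x.1.birth : ℕ) ≤ p) (h₂ : p ≤ x.1.death)
    (h₃ : (x'.1.birth : ℕ) ≤ p + δ + δ) (h₄ : p + δ + δ ≤ x'.1.death) :
    ∑ y, coefficient β' β g (p + δ) x' y * coefficient β β' f p y x = if x = x' then 1 else 0 := by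
  have hr : p + δ + δ < n := lt_of_le_of_lt h₄ x'.1.death.2
  have hq : p + δ < n := by omega
  have hx : x.1.Contains ⟨p, by omega⟩ := ⟨h₁, h₂⟩
  have hx' : x'.1.Contains ⟨p + δ + δ, hr⟩ := ⟨h₃, h₄⟩
  let a : (⟨p, by omega⟩ : Fin n) ⟶ ⟨p + δ + δ, hr⟩ :=
    homOfLE (show p ≤ p + δ + δ by omega)
  calc
    _ = ∑ y, scalar (β.vec x ⟨p, by omega⟩ ≫
          componentAt f ⟨p, by omega⟩ ⟨p + δ, hq⟩ rfl ≫
          (β'.coord y ⟨p + δ, hq⟩ ≫ β'.vec y ⟨p + δ, hq⟩) ≫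
          componentAt g ⟨p + δ, hq⟩ ⟨p + δ + δ, hr⟩ rfl ≫ β.coord x' ⟨p + δ + δ, hr⟩) := by
      refine Finset.sum_congr rfl fun y _ => ?_
      rw [coefficient, coefficient, dif_pos hq, dif_pos hr, ← scalar_comp]
      simp only [Category.assoc]
    _ = scalar (β.vec x ⟨p, by omega⟩ ≫
          componentAt f ⟨p, by omega⟩ ⟨p + δ, hq⟩ rfl ≫
          (∑ y, β'.coord y ⟨p + δ, hq⟩ ≫ β'.vec y ⟨p + δ, hq⟩) ≫
          componentAt g ⟨p + δ, hq⟩ ⟨p + δ + δ, hr⟩ rfl ≫ β.coord x' ⟨p + δ + δ, hr⟩) := by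
      rw [← scalar_sum]
      simp only [Preadditive.sum_comp, Preadditive.comp_sum]
    _ = scalar (β.vec x ⟨p + δ + δ, hr⟩ ≫ β.coord x' ⟨p + δ + δ, hr⟩) := by
      rw [β'.total, Category.id_comp,
        reassoc_of% (componentAt_comp_componentAt f g hfg _ _ _ rfl rfl a), ← β.vec_map a hx,
        Category.assoc]
    _ = _ := by
      split_ifs with h
      · subst h
        rw [β.vec_coord_self hx', scalar_id]
      · rw [β.vec_coord_of_ne _ h, scalar_zero]

/-- The algebraic stability theorem: the barcodes of `δ`-interleaved persistence modules are
`δ`-matched. -/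
theorem IsInterleavingPair.matched {f : M ⟶ (shift _ n δ).obj N} {g : N ⟶ (shift _ n δ).obj M}
    (h : IsInterleavingPair δ f g) (hB : IsBarcode M B) (hB' : IsBarcode N B') :
    Barcode.Matched δ B B' := by
  obtain ⟨β⟩ := hB.nonempty_intervalBasis
  obtain ⟨β'⟩ := hB'.nonempty_intervalBasis
  obtain ⟨s, hs, hsR⟩ := exists_injective_endpointsClose (isCoefficient_coefficient β β' f)
    (isCoefficient_coefficient β' β g) (sum_coefficient_mul β β' f g h.1)
  obtain ⟨t, ht, htR⟩ := exists_injective_endpointsClose (isCoefficient_coefficient β' β g)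
    (isCoefficient_coefficient β β' f) (sum_coefficient_mul β' β g f h.2)
  exact exists_pEquiv_of_injective
    (fun (x : B.Bar) (y : B'.Bar) =>
      EndpointsClose δ x.1.birth x.1.death y.1.birth y.1.death)
    s hs hsR t ht fun y => ⟨(htR y).2, (htR y).1⟩

end Matching

end Coefficient

end PersistenceAST

open CategoryTheory PersistenceAST in
theorem theorem4p1 {k : Type u} [Field k] [IsAlgClosed k] (n : ℕ)
    [HasDerivedCategory.{w} (Fin n ⥤ FGModuleCat.{u} k)]
    (X Y : DerivedCategory.Bounded (Fin n ⥤ FGModuleCat.{u} k)) :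
    (∀ i : ℤ, IsBarcode ((cohomology (FGModuleCat.{u} k) n i).obj X) (derivedBarcode X i)) ∧
    (∀ i : ℤ, IsBarcode ((cohomology (FGModuleCat.{u} k) n i).obj Y) (derivedBarcode Y i)) ∧
    derivedBottleneckDist (derivedBarcode X) (derivedBarcode Y) ≤ derivedInterleavingDist X Y := by
  refine ⟨fun i => isBarcode_barcode _, fun i => isBarcode_barcode _, sInf_le_sInf ?_⟩
  rintro _ ⟨δ, rfl, f, g, h⟩
  exact ⟨δ, rfl, fun i => (h i).matched (isBarcode_barcode _) (isBarcode_barcode _)⟩
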